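/- Let $B$ be a non-empty binary tree, and let $LV(B)$ (resp. $RV(B)$) be the set of its left (resp. right) vertices, i.e. the vertices that are left (resp. right) children; the root belongs to neither. A \emph{non-ambiguous tree} (NAT) $T$ of shape $B$ is a labelling of the left vertices by $1,\dots,|LV(B)|$, each label used exactly once, and of the right vertices by $1,\dots,|RV(B)|$, each label used exactly once, such that whenever $U$ and $V$ are both left vertices, or both right vertices, and $U$ is a proper ancestor of $V$, the label of $U$ is greater than the label of $V$. Let $\mathrm{NAT}(B)$ be the set of NATs of shape $B$. For $T\in\mathrm{NAT}(B)$ let $\sigma_L(T)\in\mathfrak S_{|LV(B)|}$ be the word of left labels obtained by recursively reading a tree with left subtree $L$ and right subtree $R$ in the order $L$, then $R$, then the root (whose label is read if it is a left child in $B$); let $\sigma_R(T)\in\mathfrak S_{|RV(B)|}$ be the word of right labels obtained similarly in the order $R$, then $L$, then the root. For a permutation $\sigma\in\mathfrak S_n$ let $\mathrm{inv}(\sigma)$ be the number of pairs $i<j$ with $\sigma(i)>\sigma(j)$, and let $\mathrm{imaj}(\sigma)$ be the sum of the descents of $\sigma^{-1}$, where a descent of $\tau\in\mathfrak S_n$ is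 an $i\in\{1,\dots,n-1\}$ with $\tau(i)>\tau(i+1)$. Let $q_L,q_R$ be indeterminates, and for $S\in\{\mathrm{inv},\mathrm{imaj}\}$ put $w_S(T):=q_L^{S(\sigma_L(T))}\,q_R^{S(\sigma_R(T))}$. Write $[n]_q:=\frac{1-q^n}{1-q}$ and $[n]_q!:=\prod_{i=1}^n[i]_q$. For a left (resp. right) vertex $U$ let $E_L(U)$ (resp. $E_R(U)$) be the number of left (resp. right) vertices in the subtree of $B$ with root $U$, $U$ itself included. Then, in the field $\mathbb Q(q_L,q_R)$, $$\sum_{T\in\mathrm{NAT}(B)} w_{\mathrm{inv}}(T)=\sum_{T\in\mathrm{NAT}(B)} w_{\mathrm{imaj}}(T)=\frac{[|LV(B)|]_{q_L}!\cdot[|RV(B)|]_{q_R}!}{\displaystyle\prod_{U\in LV(B)}[E_L(U)]_{q_L}\cdot\prod_{U\in RV(B)}[E_R(U)]_{q_R}}.$$ -/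

import Mathlib

/-- The two directions: a vertex that is not the root is a left child or a right child. -/
inductive Dir : Type
  | left : Dir
  | right : Dir
  deriving DecidableEq

/-- The vertices of a binary tree (Mathlib's `BinaryTree Unit`, where `nil` is the empty tree). -/
inductive Vertex : BinaryTree Unit → Type
  | root {a : Unit} {l r : BinaryTree Unit} : Vertex (.node a l r)
  | left {a : Unit} {l r : BinaryTree Unit} (v : Vertex l) : Vertex (.node a l r)
  | right {a : Unit} {l r : BinaryTree Unit} (v : Vertex r) : Vertex (.node a l r)
  deriving DecidableEq

namespace Vertex

/-- Whether a vertex is the root of the tree. -/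
def isRoot : {B : BinaryTree Unit} → Vertex B → Bool
  | _, .root => true
  | _, .left _ => false
  | _, .right _ => false

/-- Whether a vertex is a child in direction `d` of some vertex of the tree. The root is neither
a left child nor a right child. -/
def isChild (d : Dir) : {B : BinaryTree Unit} → Vertex B → Bool
  | _, .root => false
  | _, .left v => (decide (d = Dir.left) && v.isRoot) || v.isChild d
  | _, .right v => (decide (d = Dir.right) && v.isRoot) || v.isChild d

/-- `u.hasInSubtree v`: the vertex `v` belongs to the subtree with root `u` (`u` included). -/
def hasInSubtree : {B : BinaryTree Unit} → Vertex B → Vertex B → Bool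
  | _, .root, _ => true
  | _, .left u, .left v => u.hasInSubtree v
  | _, .right u, .right v => u.hasInSubtree v
  | _, .left _, .root => false
  | _, .left _, .right _ => false
  | _, .right _, .root => false
  | _, .right _, .left _ => false

/-- `u` is a (proper) ancestor of `v`. -/
def IsAncestor {B : BinaryTree Unit} (u v : Vertex B) : Prop :=
  u.hasInSubtree v = true ∧ u ≠ v

/-- The postfix order starting with direction `d`: first the vertices of the subtree in
direction `d`, then those of the other subtree, and finally the root. -/
def postfixOrder (d : Dir) : (B : BinaryTree Unit) → List (Vertex B)
  | .nil => []
  | .node _ l r =>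
    match d with
    | .left => (postfixOrder d l).map Vertex.left ++
        ((postfixOrder d r).map Vertex.right ++ [Vertex.root])
    | .right => (postfixOrder d r).map Vertex.right ++
        ((postfixOrder d l).map Vertex.left ++ [Vertex.root])

theorem mem_postfixOrder (d : Dir) {B : BinaryTree Unit} (v : Vertex B) :
    v ∈ postfixOrder d B := by
  induction v with
  | root => cases d <;> simp [postfixOrder]
  | left v ih => cases d <;> simp [postfixOrder, ih]
  | right v ih => cases d <;> simp [postfixOrder, ih]

theorem nodup_postfixOrder (d : Dir) (B : BinaryTree Unit) : (postfixOrder d B).Nodup := by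
  induction B with
  | nil => simp [postfixOrder]
  | node a l r ihl ihr =>
    have hl : Function.Injective (Vertex.left (a := a) (l := l) (r := r)) :=
      fun _ _ h => by injection h
    have hr : Function.Injective (Vertex.right (a := a) (l := l) (r := r)) :=
      fun _ _ h => by injection h
    cases d <;>
      simp [postfixOrder, List.nodup_append, List.nodup_map_iff hl, List.nodup_map_iff hr,
        ihl, ihr] <;> grind

instance (B : BinaryTree Unit) : Fintype (Vertex B) where
  elems := ⟨↑(postfixOrder Dir.left B), nodup_postfixOrder Dir.left B⟩
  complete v := mem_postfixOrder Dir.left v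

end Vertex

/-- The children in direction `d` of the vertices of `B`: the left vertices or the right vertices
of `B`. -/
abbrev ChildVertex (d : Dir) (B : BinaryTree Unit) : Type := {v : Vertex B // v.isChild d = true}

/-- The set `LV(B)` of left vertices. -/
abbrev LV (B : BinaryTree Unit) : Type := ChildVertex Dir.left B

/-- The set `RV(B)` of right vertices. -/
abbrev RV (B : BinaryTree Unit) : Type := ChildVertex Dir.right B

/-- The vertices in direction `d`, in the order of the postfix reading that starts with the
subtree in direction `d`. -/
def childPostfixOrder (d : Dir) (B : BinaryTree Unit) : List (ChildVertex d B) :=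
  (Vertex.postfixOrder d B).filterMap
    fun v => if h : v.isChild d = true then some ⟨v, h⟩ else none

theorem mem_childPostfixOrder (d : Dir) {B : BinaryTree Unit} (v : ChildVertex d B) :
    v ∈ childPostfixOrder d B :=
  List.mem_filterMap.2 ⟨v.1, Vertex.mem_postfixOrder d v.1, by simp [v.2]⟩

theorem nodup_childPostfixOrder (d : Dir) (B : BinaryTree Unit) :
    (childPostfixOrder d B).Nodup := by
  refine List.Nodup.filterMap ?_ (Vertex.nodup_postfixOrder d B)
  intro v w x hv hw
  simp only [Option.mem_def, Option.dite_none_right_eq_some, Option.some.injEq] at hv hw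
  obtain ⟨_, rfl⟩ := hv
  obtain ⟨_, h⟩ := hw
  exact (congrArg Subtype.val h).symm

theorem length_childPostfixOrder (d : Dir) (B : BinaryTree Unit) :
    (childPostfixOrder d B).length = Fintype.card (ChildVertex d B) := by
  simpa using Fintype.card_congr ((nodup_childPostfixOrder d B).getEquivOfForallMemList _
    (mem_childPostfixOrder d))

/-- The position in the postfix reading: position `i` (counted from `0`) is sent to the `i`-th
vertex in direction `d`. -/
def postfixEquiv (d : Dir) (B : BinaryTree Unit) :
    Fin (Fintype.card (ChildVertex d B)) ≃ ChildVertex d B :=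
  (finCongr (length_childPostfixOrder d B).symm).trans
    ((nodup_childPostfixOrder d B).getEquivOfForallMemList _ (mem_childPostfixOrder d))

/-- A non-ambiguous tree of shape `B`. The left vertices carry the labels `1, …, |LV(B)|`, each
exactly once, and the right vertices the labels `1, …, |RV(B)|`, each exactly once; the label
`k + 1` is represented by the element `k` of `Fin`. Along ancestors, the labels of left vertices
and the labels of right vertices decrease. -/
@[ext]
structure NAT (B : BinaryTree Unit) where
  leftLabel : LV B ≃ Fin (Fintype.card (LV B))
  rightLabel : RV B ≃ Fin (Fintype.card (RV B))
  left_decreasing : ∀ u v : LV B, Vertex.IsAncestor u.1 v.1 → leftLabel v < leftLabel u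
  right_decreasing : ∀ u v : RV B, Vertex.IsAncestor u.1 v.1 → rightLabel v < rightLabel u

namespace NAT

noncomputable instance (B : BinaryTree Unit) : Fintype (NAT B) :=
  Fintype.ofInjective (fun T : NAT B => (T.leftLabel, T.rightLabel)) fun _ _ h =>
    NAT.ext (congrArg Prod.fst h) (congrArg Prod.snd h)

/-- The permutation `σ_L(T)`: its `i`-th value is the `i`-th left label in the postfix reading
(left subtree, right subtree, root). -/
def sigmaL {B : BinaryTree Unit} (T : NAT B) : Equiv.Perm (Fin (Fintype.card (LV B))) :=
  (postfixEquiv Dir.left B).trans T.leftLabel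

/-- The permutation `σ_R(T)`: its `i`-th value is the `i`-th right label in the postfix reading
(right subtree, left subtree, root). -/
def sigmaR {B : BinaryTree Unit} (T : NAT B) : Equiv.Perm (Fin (Fintype.card (RV B))) :=
  (postfixEquiv Dir.right B).trans T.rightLabel

end NAT

/-- The number of inversions of a permutation. -/
def permInv (n : ℕ) (σ : Equiv.Perm (Fin n)) : ℕ :=
  (Finset.univ.filter fun p : Fin n × Fin n => p.1 < p.2 ∧ σ p.2 < σ p.1).card

/-- The sum of the descents of a permutation. Positions are counted from `1`, so that the element
`i` of `Fin n` is the position `i + 1`. -/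
def permMaj (n : ℕ) (σ : Equiv.Perm (Fin n)) : ℕ :=
  ∑ i : Fin n, if ∃ h : i.1 + 1 < n, σ ⟨i.1 + 1, h⟩ < σ i then i.1 + 1 else 0

/-- The inverse major index: the sum of the descents of the inverse permutation. -/
def permImaj (n : ℕ) (σ : Equiv.Perm (Fin n)) : ℕ := permMaj n σ⁻¹

/-- The weight `q_L ^ S(σ_L(T)) * q_R ^ S(σ_R(T))` of a non-ambiguous tree, for a statistic `S` on
permutations. -/
def NAT.weight {K : Type*} [Field K] (qL qR : K) (S : (n : ℕ) → Equiv.Perm (Fin n) → ℕ)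
    {B : BinaryTree Unit} (T : NAT B) : K :=
  qL ^ S _ T.sigmaL * qR ^ S _ T.sigmaR

/-- The `q`-integer `[n]_q = (1 - q ^ n) / (1 - q)`. -/
def qInt {K : Type*} [Field K] (q : K) (n : ℕ) : K := (1 - q ^ n) / (1 - q)

/-- The `q`-factorial `[n]_q! = [1]_q [2]_q ⋯ [n]_q`. -/
def qFactorial {K : Type*} [Field K] (q : K) (n : ℕ) : K := ∏ i ∈ Finset.Icc 1 n, qInt q i

/-- The hook size of a vertex `U` in direction `d`: the number of vertices in direction `d` that
belong to the subtree with root `U` (`U` itself is included). -/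
def hookSize {d : Dir} {B : BinaryTree Unit} (U : ChildVertex d B) : ℕ :=
  (Finset.univ.filter fun v : ChildVertex d B => U.1.hasInSubtree v.1 = true).card

/-- The field `ℚ(q_L, q_R)` of rational functions in two indeterminates. -/
abbrev QField : Type := FractionRing (MvPolynomial Dir ℚ)

/-- The indeterminate `q_L` or `q_R`. -/
noncomputable def qVar (d : Dir) : QField :=
  algebraMap (MvPolynomial Dir ℚ) QField (MvPolynomial.X d)

section QIntegers

variable {K : Type*} [Field K] {q : K}

theorem qInt_add (q : K) (m n : ℕ) : qInt q (m + n) = qInt q m + q ^ m * qInt q n := by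
  unfold qInt
  rw [← mul_div_assoc, ← add_div]
  congr 1
  ring

theorem qFactorial_zero (q : K) : qFactorial q 0 = 1 := by simp [qFactorial]

theorem qFactorial_succ (q : K) (n : ℕ) :
    qFactorial q (n + 1) = qFactorial q n * qInt q (n + 1) := by
  simp [qFactorial, Finset.prod_Icc_succ_top]

theorem qFactorial_ne_zero (hq : ∀ n, 0 < n → qInt q n ≠ 0) (n : ℕ) : qFactorial q n ≠ 0 :=
  Finset.prod_ne_zero_iff.2 fun i hi => hq i (Finset.mem_Icc.1 hi).1

/-- The Gaussian binomial coefficient `[m + n]_q! / ([m]_q! [n]_q!)`. -/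
def qChoose (q : K) (m n : ℕ) : K := qFactorial q (m + n) / (qFactorial q m * qFactorial q n)

theorem qChoose_zero_left (hq : ∀ n, 0 < n → qInt q n ≠ 0) (n : ℕ) : qChoose q 0 n = 1 := by
  simp [qChoose, qFactorial_zero, div_self (qFactorial_ne_zero hq n)]

theorem qChoose_zero_right (hq : ∀ n, 0 < n → qInt q n ≠ 0) (n : ℕ) : qChoose q n 0 = 1 := by
  simp [qChoose, qFactorial_zero, div_self (qFactorial_ne_zero hq n)]

theorem qChoose_comm (q : K) (m n : ℕ) : qChoose q m n = qChoose q n m := by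
  rw [qChoose, qChoose, add_comm, mul_comm]

theorem qChoose_succ_succ (hq : ∀ n, 0 < n → qInt q n ≠ 0) (m n : ℕ) :
    qChoose q (m + 1) (n + 1) = qChoose q m (n + 1) + q ^ (m + 1) * qChoose q (m + 1) n := by
  have h1 := qFactorial_ne_zero hq m
  have h2 := qFactorial_ne_zero hq n
  have h3 := hq (m + 1) (by omega)
  have h4 := hq (n + 1) (by omega)
  have h5 := qInt_add q (m + 1) (n + 1)
  have e : qFactorial q (m + 1 + (n + 1)) =
      qFactorial q (m + n + 1) * qInt q (m + 1 + (n + 1)) := by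
    rw [show m + 1 + (n + 1) = m + n + 1 + 1 by omega, qFactorial_succ]
  have e1 : m + (n + 1) = m + n + 1 := by omega
  have e2 : m + 1 + n = m + n + 1 := by omega
  simp only [qChoose, e, e1, e2, qFactorial_succ q m, qFactorial_succ q n, h5]
  field_simp

theorem qChoose_succ_succ' (hq : ∀ n, 0 < n → qInt q n ≠ 0) (m n : ℕ) :
    qChoose q (m + 1) (n + 1) = q ^ (n + 1) * qChoose q m (n + 1) + qChoose q (m + 1) n := by
  rw [qChoose_comm, qChoose_succ_succ hq, qChoose_comm q n, qChoose_comm q (n + 1) m, add_comm]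

end QIntegers

/-- The major index of the reversal of a word. -/
def revMaj : List ℕ → ℕ
  | [] => 0
  | a :: w => revMaj w + if (∃ b ∈ w.head?, a < b) then w.length else 0

/-- The number of inversions of the reversal of a word. -/
def revInv : List ℕ → ℕ
  | [] => 0
  | a :: w => revInv w + w.countP (a < ·)

theorem revMaj_cons_cons (a b : ℕ) (w : List ℕ) :
    revMaj (a :: b :: w) = revMaj (b :: w) + if a < b then w.length + 1 else 0 := by
  simp [revMaj]

/-- The shuffles of two words. -/
def shuffle {α β : Type*} : List α → List β → List (List (α ⊕ β))
  | [], v => [v.map Sum.inr]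
  | a :: u, [] => [(a :: u).map Sum.inl]
  | a :: u, b :: v =>
    (shuffle u (b :: v)).map (Sum.inl a :: ·) ++ (shuffle (a :: u) v).map (Sum.inr b :: ·)

section Shuffle

variable {α β : Type*}

theorem shuffle_nil_right (u : List α) : shuffle u ([] : List β) = [u.map Sum.inl] := by
  cases u <;> simp [shuffle]

theorem mem_shuffle {u : List α} {v : List β} {w : List (α ⊕ β)} :
    w ∈ shuffle u v ↔ w.filterMap Sum.getLeft? = u ∧ w.filterMap Sum.getRight? = v := by
  induction w generalizing u v with
  | nil =>
    rcases u with _ | ⟨a, u⟩ <;> rcases v with _ | ⟨b, v⟩ <;> simp [shuffle]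
  | cons x w ih =>
    rcases u with _ | ⟨a, u⟩ <;> rcases v with _ | ⟨b, v⟩ <;> rcases x with x | x
    all_goals simp only [shuffle, List.mem_append, List.mem_map, List.cons.injEq,
      List.mem_singleton, List.map_nil, List.map_cons, reduceCtorEq, false_and,
      Sum.inl.injEq, Sum.inr.injEq, exists_eq_right_right, and_false, exists_false, or_false,
      false_or, ih, List.filterMap_cons, Sum.getLeft?_inl, Sum.getLeft?_inr, Sum.getRight?_inl,
      Sum.getRight?_inr]
    · have := @ih [] v
      simp only [shuffle, List.mem_singleton] at this
      rw [this]; tauto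
    · have := @ih u []
      simp only [shuffle_nil_right, List.mem_singleton] at this
      rw [this]; tauto
    · tauto
    · tauto

theorem length_of_mem_shuffle {u : List α} {v : List β} {w : List (α ⊕ β)}
    (h : w ∈ shuffle u v) : w.length = u.length + v.length := by
  obtain ⟨rfl, rfl⟩ := mem_shuffle.1 h
  clear h
  induction w with
  | nil => rfl
  | cons x w ih => cases x <;> simp [ih, List.filterMap_cons] <;> omega

theorem countP_of_mem_shuffle {u : List α} {v : List β} {w : List (α ⊕ β)}
    (h : w ∈ shuffle u v) (p : α ⊕ β → Bool) :
    w.countP p = u.countP (p <| .inl ·) + v.countP (p <| .inr ·) := by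
  obtain ⟨rfl, rfl⟩ := mem_shuffle.1 h
  clear h
  induction w with
  | nil => rfl
  | cons x w ih => cases x <;> simp [ih, List.countP_cons, List.filterMap_cons] <;> omega

theorem nodup_shuffle (u : List α) (v : List β) : (shuffle u v).Nodup := by
  induction u generalizing v with
  | nil => simp [shuffle]
  | cons a u ihu =>
    induction v with
    | nil => simp [shuffle]
    | cons b v ihv =>
      rw [shuffle, List.nodup_append]
      refine ⟨(ihu _).map (List.cons_injective), ihv.map (List.cons_injective), ?_⟩
      simp

variable {K : Type*} [Field K] {q : K}

theorem sum_shuffle_revMaj_cons (f : α → ℕ) (g : β → ℕ) (c : ℕ) (a : α) (u : List α) (b : β)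
    (v : List β) :
    ((shuffle (a :: u) (b :: v)).map fun w => q ^ revMaj (c :: w.map (Sum.elim f g))).sum =
      q ^ (if c < f a then u.length + v.length + 2 else 0) *
        ((shuffle u (b :: v)).map fun w => q ^ revMaj (f a :: w.map (Sum.elim f g))).sum +
      q ^ (if c < g b then u.length + v.length + 2 else 0) *
        ((shuffle (a :: u) v).map fun w => q ^ revMaj (g b :: w.map (Sum.elim f g))).sum := by
  rw [shuffle, List.map_append, List.sum_append, List.map_map, List.map_map,
    ← List.sum_map_mul_left, ← List.sum_map_mul_left]
  congr 2 <;>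
  · refine List.map_congr_left fun w hw => ?_
    have := length_of_mem_shuffle hw
    simp only [List.length_cons] at this
    simp only [Function.comp_apply, List.map_cons, Sum.elim_inl, Sum.elim_inr, revMaj_cons_cons,
      pow_add _ (revMaj _), List.length_map, this]
    rw [mul_comm]
    congr 3
    all_goals omega

/-- The generating function of the major index over the shuffles of two words that end with a
given letter. -/
theorem sum_shuffle_revMaj_head (hq : ∀ n, 0 < n → qInt q n ≠ 0) (f : α → ℕ) (g : β → ℕ)
    (hfg : ∀ x y, f x ≠ g y) (a : α) (u : List α) (b : β) (v : List β) :
    ((shuffle u (b :: v)).map fun w => q ^ revMaj (f a :: w.map (Sum.elim f g))).sum =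
      q ^ (revMaj ((a :: u).map f) + revMaj ((b :: v).map g) +
        if f a < g b then v.length + 1 else 0) * qChoose q u.length (v.length + 1) ∧
    ((shuffle (a :: u) v).map fun w => q ^ revMaj (g b :: w.map (Sum.elim f g))).sum =
      q ^ (revMaj ((a :: u).map f) + revMaj ((b :: v).map g) +
        if g b < f a then u.length + 1 else 0) * qChoose q (u.length + 1) v.length := by
  obtain ⟨n, hn⟩ : ∃ n, n = u.length + v.length := ⟨_, rfl⟩
  induction n using Nat.strong_induction_on generalizing a b u v with
  | _ n ih =>
  constructor
  · rcases u with _ | ⟨d, u⟩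
    · simp [shuffle, revMaj, qChoose_zero_left hq, Function.comp_def]
    · obtain ⟨h1, h2⟩ := ih _ (by simp at hn; omega) d u b v rfl
      rw [sum_shuffle_revMaj_cons, h1, h2]
      simp only [List.map_cons, revMaj_cons_cons (f a), List.length_cons, List.length_map]
      have n1 := hfg a b
      have n2 := hfg d b
      generalize revMaj (f d :: u.map f) = x
      generalize revMaj (g b :: v.map g) = y
      have p1 := qChoose_succ_succ hq u.length v.length
      have p2 := qChoose_succ_succ' hq u.length v.length
      split_ifs <;> first | omega | skip
      all_goals simp only [pow_add, pow_zero, pow_one] at p1 p2 ⊢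
      all_goals first
        | (rw [p1]; ring1) | (rw [p2]; ring1)
  · rcases v with _ | ⟨d, v⟩
    · simp [shuffle_nil_right, revMaj, qChoose_zero_right hq, Function.comp_def]
    · obtain ⟨h1, h2⟩ := ih _ (by simp at hn; omega) a u d v rfl
      rw [sum_shuffle_revMaj_cons, h1, h2]
      simp only [List.map_cons, revMaj_cons_cons (g b), List.length_cons, List.length_map]
      have n1 := hfg a b
      have n2 := hfg a d
      generalize revMaj (f a :: u.map f) = x
      generalize revMaj (g d :: v.map g) = y
      have p1 := qChoose_succ_succ hq u.length v.length
      have p2 := qChoose_succ_succ' hq u.length v.length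
      split_ifs <;> first | omega | skip
      all_goals simp only [pow_add, pow_zero, pow_one] at p1 p2 ⊢
      all_goals first
        | (rw [p1]; ring1) | (rw [p2]; ring1)

/-- The generating function of the major index over the shuffles of two words without common
letters. -/
theorem sum_shuffle_revMaj (hq : ∀ n, 0 < n → qInt q n ≠ 0) (f : α → ℕ) (g : β → ℕ)
    (hfg : ∀ x y, f x ≠ g y) (u : List α) (v : List β) :
    ((shuffle u v).map fun w => q ^ revMaj (w.map (Sum.elim f g))).sum =
      q ^ revMaj (u.map f) * q ^ revMaj (v.map g) * qChoose q u.length v.length := by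
  rcases u with _ | ⟨a, u⟩
  · simp [shuffle, revMaj, qChoose_zero_left hq, Function.comp_def]
  rcases v with _ | ⟨b, v⟩
  · simp [shuffle, revMaj, qChoose_zero_right hq, Function.comp_def]
  obtain ⟨h1, h2⟩ := sum_shuffle_revMaj_head hq f g hfg a u b v
  rw [shuffle, List.map_append, List.sum_append, List.map_map, List.map_map]
  simp only [Function.comp_def, List.map_cons, Sum.elim_inl, Sum.elim_inr] at h1 h2 ⊢
  rw [h1, h2]
  have n1 := hfg a b
  have p1 := qChoose_succ_succ hq u.length v.length
  have p2 := qChoose_succ_succ' hq u.length v.length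
  simp only [List.length_cons]
  split_ifs <;> first | omega | skip
  · rw [p2]; ring
  · rw [p1]; ring

/-- The generating function of the inversion number over the shuffles of two words, if all
letters of one word are smaller than all letters of the other. -/
theorem sum_shuffle_revInv (hq : ∀ n, 0 < n → qInt q n ≠ 0) (f : α → ℕ) (g : β → ℕ)
    (hfg : (∀ x y, f x < g y) ∨ ∀ x y, g y < f x) (u : List α) (v : List β) :
    ((shuffle u v).map fun w => q ^ revInv (w.map (Sum.elim f g))).sum =
      q ^ revInv (u.map f) * q ^ revInv (v.map g) * qChoose q u.length v.length := by
  induction u generalizing v with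
  | nil => simp [shuffle, revInv, qChoose_zero_left hq, Function.comp_def]
  | cons a u ihu =>
    induction v with
    | nil => simp [shuffle, revInv, qChoose_zero_right hq, Function.comp_def]
    | cons b v ihv =>
      have key (x : α ⊕ β) (c : ℕ) (hc : Sum.elim f g x = c) {u' : List α} {v' : List β} {w : List (α ⊕ β)}
          (hw : w ∈ shuffle u' v') :
          q ^ revInv ((x :: w).map (Sum.elim f g)) =
            q ^ ((u'.map f).countP (c < ·) + (v'.map g).countP (c < ·)) * q ^ revInv (w.map (Sum.elim f g)) := by
        rw [List.map_cons, hc, revInv, pow_add, mul_comm, List.countP_map, List.countP_map,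
          List.countP_map, countP_of_mem_shuffle hw]
        rfl
      rw [shuffle, List.map_append, List.sum_append, List.map_map, List.map_map]
      simp only [Function.comp_def]
      rw [List.map_congr_left fun w hw => key (.inl a) (f a) rfl hw,
        List.map_congr_left fun w hw => key (.inr b) (g b) rfl hw,
        List.sum_map_mul_left, List.sum_map_mul_left, ihu, ihv]
      simp only [List.map_cons, revInv, List.length_cons]
      rcases hfg with h | h
      · have e1 : (g b :: v.map g).countP (f a < ·) = v.length + 1 := by
          rw [List.countP_eq_length.2 (by simp [h])]; simp
        have e2 : (f a :: u.map f).countP (g b < ·) = 0 := by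
          simp [List.countP_eq_zero, (h _ _).le]
        rw [e1, e2, qChoose_succ_succ' hq]
        ring
      · have e1 : (g b :: v.map g).countP (f a < ·) = 0 := by
          simp [List.countP_eq_zero, (h _ _).le]
        have e2 : (f a :: u.map f).countP (g b < ·) = u.length + 1 := by
          rw [List.countP_eq_length.2 (by simp [h])]; simp
        rw [e1, e2, qChoose_succ_succ hq]
        ring

end Shuffle

namespace Vertex

/-- The vertices of a non-empty tree other than the root, from the vertices of the two
subtrees. -/
def ofSubtree {a : Unit} {l r : BinaryTree Unit} : Vertex l ⊕ Vertex r → Vertex (.node a l r) :=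
  Sum.elim Vertex.left Vertex.right

theorem ofSubtree_injective {a : Unit} {l r : BinaryTree Unit} :
    Function.Injective (ofSubtree (a := a) (l := l) (r := r)) := by
  rintro (x | x) (y | y) h <;> simp_all [ofSubtree]

/-- A vertex of a non-empty tree is the root or a vertex of one of the two subtrees. -/
def nodeEquiv (a : Unit) (l r : BinaryTree Unit) :
    Option (Vertex l ⊕ Vertex r) ≃ Vertex (.node a l r) where
  toFun x := x.elim root ofSubtree
  invFun
    | .root => none
    | .left v => some (.inl v)
    | .right v => some (.inr v)
  left_inv := by rintro (_ | _ | _) <;> rfl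
  right_inv := by rintro (_ | _ | _) <;> rfl

@[to_additive]
theorem prod_node {M : Type*} [CommMonoid M] {a : Unit} {l r : BinaryTree Unit}
    (f : Vertex (.node a l r) → M) :
    ∏ v, f v = f root * ((∏ v, f (.left v)) * ∏ v, f (.right v)) := by
  rw [← Fintype.prod_equiv (nodeEquiv a l r) _ f fun _ => rfl, Fintype.prod_option,
    Fintype.prod_sum_type]
  rfl

/-- Whether `v` is a child in direction `d` of a vertex of the tree, or of a further vertex whose
child in direction `d` is the root (if `b` is true). -/
def isChildOrRoot (d : Dir) (b : Bool) {B : BinaryTree Unit} (v : Vertex B) : Bool :=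
  (b && v.isRoot) || v.isChild d

section

variable (d : Dir) (b : Bool) {a : Unit} {l r : BinaryTree Unit}

@[simp]
theorem isChildOrRoot_root : (root : Vertex (.node a l r)).isChildOrRoot d b = b := by
  simp [isChildOrRoot, isRoot, isChild]

@[simp]
theorem isChildOrRoot_left (v : Vertex l) :
    (left v : Vertex (.node a l r)).isChildOrRoot d b = v.isChildOrRoot d (d = Dir.left) := by
  simp [isChildOrRoot, isRoot, isChild]

@[simp]
theorem isChildOrRoot_right (v : Vertex r) :
    (right v : Vertex (.node a l r)).isChildOrRoot d b = v.isChildOrRoot d (d = Dir.right) := by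
  simp [isChildOrRoot, isRoot, isChild]

end

/-- The position of a vertex in the postfix order. -/
def postfixRank (d : Dir) : {B : BinaryTree Unit} → Vertex B → ℕ
  | .node _ l r, .root => l.numNodes + r.numNodes
  | .node _ _ r, .left v => (if d = Dir.left then 0 else r.numNodes) + v.postfixRank d
  | .node _ l _, .right v => (if d = Dir.left then l.numNodes else 0) + v.postfixRank d

theorem postfixRank_lt (d : Dir) {B : BinaryTree Unit} (v : Vertex B) :
    v.postfixRank d < B.numNodes := by
  induction v with
  | root => simp [postfixRank, BinaryTree.numNodes]
  | left v ih | right v ih => simp only [postfixRank, BinaryTree.numNodes]; split_ifs <;> omega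

theorem pairwise_postfixOrder (d : Dir) (B : BinaryTree Unit) :
    (postfixOrder d B).Pairwise fun u v => u.postfixRank d < v.postfixRank d := by
  induction B with
  | nil => simp [postfixOrder]
  | node a l r ihl ihr =>
    cases d <;>
    · simp only [postfixOrder, List.pairwise_append, List.pairwise_map, List.mem_map,
        List.mem_append, List.pairwise_singleton, List.mem_singleton, postfixRank]
      refine ⟨by simpa using ‹_›, ⟨by simpa using ‹_›, trivial, ?_⟩, ?_⟩
      · rintro _ ⟨x, -, rfl⟩ _ rfl
        have := x.postfixRank_lt
        grind [postfixRank]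
      · rintro _ ⟨x, -, rfl⟩ _ (⟨y, -, rfl⟩ | rfl) <;>
        · have := x.postfixRank_lt
          grind [postfixRank]

/-- The reversed linear extensions of the set of vertices in direction `d` (together with the
root if `b` is true), ordered by ancestry: all words in which each of these vertices occurs once,
after all its ancestors. -/
def linExt (d : Dir) : Bool → (B : BinaryTree Unit) → List (List (Vertex B))
  | _, .nil => [[]]
  | b, .node _ l r =>
    (linExt d (d = Dir.left) l).flatMap fun u =>
      (linExt d (d = Dir.right) r).flatMap fun v =>
        (shuffle u v).map fun w => (if b then [root] else []) ++ w.map ofSubtree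

theorem hasInSubtree_self {B : BinaryTree Unit} (v : Vertex B) : v.hasInSubtree v = true := by
  induction v with
  | root => rfl
  | left v ih | right v ih => simpa [hasInSubtree] using ih

theorem ofSubtree_ne_root {a : Unit} {l r : BinaryTree Unit} (x : Vertex l ⊕ Vertex r) :
    (ofSubtree x : Vertex (.node a l r)) ≠ root := by
  rcases x with x | x <;> simp [ofSubtree]

theorem hasInSubtree_ofSubtree_root {a : Unit} {l r : BinaryTree Unit}
    (x : Vertex l ⊕ Vertex r) :
    (ofSubtree x : Vertex (.node a l r)).hasInSubtree root = false := by
  rcases x with x | x <;> simp [ofSubtree, hasInSubtree]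

theorem exists_map_ofSubtree {a : Unit} {l r : BinaryTree Unit} (w : List (Vertex (.node a l r)))
    (h : root ∉ w) : ∃ w' : List (Vertex l ⊕ Vertex r), w = w'.map ofSubtree := by
  induction w with
  | nil => exact ⟨[], rfl⟩
  | cons x w ih =>
    obtain ⟨w', rfl⟩ := ih fun h' => h (List.mem_cons_of_mem _ h')
    rcases x with _ | x | x
    · simp at h
    · exact ⟨.inl x :: w', rfl⟩
    · exact ⟨.inr x :: w', rfl⟩

/-- Whether a word is a reversed linear extension. -/
def IsLinExt (d : Dir) (b : Bool) {B : BinaryTree Unit} (w : List (Vertex B)) : Prop :=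
  (∀ v, v ∈ w ↔ v.isChildOrRoot d b = true) ∧
    w.Pairwise fun u v => ¬ v.hasInSubtree u = true

theorem isLinExt_map_ofSubtree (d : Dir) {a : Unit} {l r : BinaryTree Unit}
    (w : List (Vertex l ⊕ Vertex r)) :
    IsLinExt d false (w.map (ofSubtree (a := a))) ↔
      IsLinExt d (d = Dir.left) (w.filterMap Sum.getLeft?) ∧
      IsLinExt d (d = Dir.right) (w.filterMap Sum.getRight?) := by
  have h1 : (∀ v, v ∈ w.map (ofSubtree (a := a)) ↔ v.isChildOrRoot d false = true) ↔
      (∀ v, v ∈ w.filterMap Sum.getLeft? ↔ v.isChildOrRoot d (d = Dir.left) = true) ∧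
      (∀ v, v ∈ w.filterMap Sum.getRight? ↔ v.isChildOrRoot d (d = Dir.right) = true) := by
    rw [← (nodeEquiv a l r).forall_congr_right, Option.forall, Sum.forall]
    have e (x) : ofSubtree (a := a) x ∈ w.map (ofSubtree (a := a)) ↔ x ∈ w :=
      List.mem_map_of_injective ofSubtree_injective
    have e1 (x : Vertex l) : (nodeEquiv a l r) (some (.inl x)) = left x := rfl
    have e2 (x : Vertex r) : (nodeEquiv a l r) (some (.inr x)) = right x := rfl
    have e3 : (nodeEquiv a l r) none = root := rfl
    have e' (x) := e (.inl x)
    have e'' (x) := e (.inr x)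
    simp only [ofSubtree, Sum.elim_inl, Sum.elim_inr] at e' e''
    simp only [e1, e2, e3, isChildOrRoot_left, isChildOrRoot_right, isChildOrRoot_root]
    simp only [ofSubtree, e', e'']
    simp
  rw [IsLinExt, h1, IsLinExt, IsLinExt, List.pairwise_map, List.pairwise_filterMap,
    List.pairwise_filterMap, and_and_and_comm, ← List.pairwise_and_iff]
  refine and_congr_right fun _ => iff_of_eq ?_
  congr 1
  ext x y
  rcases x with x | x <;> rcases y with y | y <;> simp [ofSubtree, hasInSubtree]

theorem isLinExt_root_cons (d : Dir) {a : Unit} {l r : BinaryTree Unit}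
    (w : List (Vertex l ⊕ Vertex r)) :
    IsLinExt d true (root :: w.map (ofSubtree (a := a))) ↔
      IsLinExt d false (w.map (ofSubtree (a := a))) := by
  have e (v : Vertex (.node a l r)) : (v ∈ root :: w.map (ofSubtree (a := a)) ↔
      v.isChildOrRoot d true = true) ↔
      (v ∈ w.map (ofSubtree (a := a)) ↔ v.isChildOrRoot d false = true) := by
    rcases v with _ | v | v <;> simp [ofSubtree_ne_root]
  simp only [IsLinExt, e, List.pairwise_cons]
  refine and_congr_right fun _ => and_iff_right ?_
  simp only [List.mem_map]
  rintro _ ⟨x, -, rfl⟩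
  simp [hasInSubtree_ofSubtree_root]

theorem mem_linExt {d : Dir} {b : Bool} {B : BinaryTree Unit} {w : List (Vertex B)} :
    w ∈ linExt d b B ↔ IsLinExt d b w := by
  induction B generalizing b with
  | nil =>
    rcases w with _ | ⟨⟨⟩, _⟩
    simp only [linExt, List.mem_singleton, IsLinExt, List.Pairwise.nil, and_true, true_iff]
    rintro ⟨⟩
  | node a l r ihl ihr =>
    have key (w' : List (Vertex l ⊕ Vertex r)) : (∃ u ∈ linExt d (d = Dir.left) l,
        ∃ v ∈ linExt d (d = Dir.right) r, w' ∈ shuffle u v) ↔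
        IsLinExt d false (w'.map (ofSubtree (a := a))) := by
      simp [isLinExt_map_ofSubtree, mem_shuffle, ihl, ihr]
    have key2 : w ∈ linExt d b (.node a l r) ↔
        ∃ w' : List (Vertex l ⊕ Vertex r), IsLinExt d false (w'.map (ofSubtree (a := a))) ∧
          w = (if b then [root] else []) ++ w'.map ofSubtree := by
      simp only [linExt, List.mem_flatMap, List.mem_map, ← key]
      grind
    rw [key2]
    cases b
    · constructor
      · rintro ⟨w', h, rfl⟩
        simpa using h
      · intro h
        obtain ⟨w', rfl⟩ := exists_map_ofSubtree w (by simp [h.1])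
        exact ⟨w', h, by simp⟩
    · constructor
      · rintro ⟨w', h, rfl⟩
        simpa [isLinExt_root_cons] using h
      · intro h
        rcases w with _ | ⟨x, w⟩
        · simpa using h.1 root
        · have hx : x = root := by
            by_contra hx
            have := (h.1 root).2 (by simp)
            rcases List.mem_cons.1 this with h' | h'
            · exact hx h'.symm
            · exact (List.pairwise_cons.1 h.2).1 _ h' rfl
          subst hx
          obtain ⟨w', rfl⟩ := exists_map_ofSubtree w fun h' =>
            (List.pairwise_cons.1 h.2).1 _ h' rfl
          exact ⟨w', (isLinExt_root_cons d w').1 h, by simp⟩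

theorem nodup_linExt (d : Dir) (b : Bool) (B : BinaryTree Unit) : (linExt d b B).Nodup := by
  induction B generalizing b with
  | nil => simp [linExt]
  | node a l r ihl ihr =>
    have hinj : Function.Injective fun w : List (Vertex l ⊕ Vertex r) =>
        (if b then [root] else []) ++ w.map (ofSubtree (a := a)) :=
      fun w w' h => List.map_injective_iff.2 ofSubtree_injective (List.append_cancel_left h)
    rw [linExt, List.nodup_flatMap]
    refine ⟨fun u _ => ?_, (ihl _).imp fun {u u'} huu => ?_⟩
    · rw [List.nodup_flatMap]
      refine ⟨fun v _ => (nodup_shuffle u v).map hinj, (ihr _).imp fun {v v'} hvv => ?_⟩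
      simp only [Function.onFun, List.disjoint_left, List.mem_map]
      rintro _ ⟨w, hw, rfl⟩ ⟨w', hw', h⟩
      obtain rfl := hinj h
      exact hvv ((mem_shuffle.1 hw).2.symm.trans (mem_shuffle.1 hw').2)
    · simp only [Function.onFun, List.disjoint_left, List.mem_map, List.mem_flatMap]
      rintro _ ⟨v, -, w, hw, rfl⟩ ⟨v', -, w', hw', h⟩
      obtain rfl := hinj h
      exact huu ((mem_shuffle.1 hw).1.symm.trans (mem_shuffle.1 hw').1)

/-- The number of vertices in direction `d`, together with the root if `b` is true. -/
def numChildOrRoot (d : Dir) (b : Bool) (B : BinaryTree Unit) : ℕ :=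
  ∑ v : Vertex B, if v.isChildOrRoot d b = true then 1 else 0

theorem numChildOrRoot_node (d : Dir) (b : Bool) (a : Unit) (l r : BinaryTree Unit) :
    numChildOrRoot d b (.node a l r) = (if b then 1 else 0) +
      (numChildOrRoot d (d = Dir.left) l + numChildOrRoot d (d = Dir.right) r) := by
  simp [numChildOrRoot, sum_node, -Finset.sum_boole]

theorem length_of_mem_linExt {d : Dir} {b : Bool} {B : BinaryTree Unit} {w : List (Vertex B)}
    (h : w ∈ linExt d b B) : w.length = numChildOrRoot d b B := by
  induction B generalizing b with
  | nil =>
    simp only [linExt, List.mem_singleton] at h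
    simp only [h, numChildOrRoot, List.length_nil]
    rfl
  | node a l r ihl ihr =>
    simp only [linExt, List.mem_flatMap, List.mem_map] at h
    obtain ⟨u, hu, v, hv, w, hw, rfl⟩ := h
    rw [numChildOrRoot_node, ← ihl hu, ← ihr hv]
    cases b <;> simp [length_of_mem_shuffle hw, add_comm]

/-- The product of the `q`-hook sizes in the forest of the vertices in direction `d`, together
with the root if `b` is true. -/
def hookProd {K : Type*} [Field K] (q : K) (d : Dir) (b : Bool) (B : BinaryTree Unit) : K :=
  ∏ v : Vertex B, if v.isChildOrRoot d b = true then
    qInt q (∑ w : Vertex B,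
      if w.isChildOrRoot d b = true ∧ v.hasInSubtree w = true then 1 else 0) else 1

variable {K : Type*} [Field K] {q : K}

theorem hookProd_node (d : Dir) (b : Bool) (a : Unit) (l r : BinaryTree Unit) :
    hookProd q d b (.node a l r) =
      (if b then qInt q (numChildOrRoot d b (.node a l r)) else 1) *
        (hookProd q d (d = Dir.left) l * hookProd q d (d = Dir.right) r) := by
  rw [hookProd, prod_node, hookProd, hookProd]
  simp [sum_node, hasInSubtree, numChildOrRoot, -Finset.sum_boole]

theorem _root_.List.sum_map_flatMap_eq {M α β : Type*} [AddMonoid M] (l : List α)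
    (f : α → List β) (g : β → M) :
    ((l.flatMap f).map g).sum = (l.map fun x => ((f x).map g).sum).sum := by
  induction l with
  | nil => rfl
  | cons a l ih => simp [ih]

/-- The `q`-hook length formula for the linear extensions of the forest of the vertices in
direction `d`, for a statistic that behaves well with respect to shuffles and to prepending a
maximal letter. -/
theorem sum_linExt_mul_hookProd (hq : ∀ n, 0 < n → qInt q n ≠ 0) (stat : List ℕ → ℕ)
    (hnil : stat [] = 0) (hcons : ∀ a w, (∀ b ∈ w, b < a) → stat (a :: w) = stat w)
    (hshuffle : ∀ (α β : Type) (f : α → ℕ) (g : β → ℕ),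
      ((∀ x y, f x < g y) ∨ ∀ x y, g y < f x) → ∀ (u : List α) (v : List β),
      ((shuffle u v).map fun w => q ^ stat (w.map (Sum.elim f g))).sum =
        q ^ stat (u.map f) * q ^ stat (v.map g) * qChoose q u.length v.length)
    (d : Dir) (b : Bool) (B : BinaryTree Unit) (c : ℕ) :
    ((linExt d b B).map fun w => q ^ stat (w.map fun v => c + v.postfixRank d)).sum *
      hookProd q d b B = qFactorial q (numChildOrRoot d b B) := by
  induction B generalizing b c with
  | nil =>
    have h1 : hookProd q d b .nil = 1 := rfl
    have h2 : numChildOrRoot d b .nil = 0 := rfl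
    simp [linExt, hnil, h1, h2, qFactorial_zero]
  | node a l r ihl ihr =>
    set f : Vertex l → ℕ := fun v =>
      (c + if d = Dir.left then 0 else r.numNodes) + v.postfixRank d with hf
    set g : Vertex r → ℕ := fun v =>
      (c + if d = Dir.left then l.numNodes else 0) + v.postfixRank d with hg
    have hfg : (∀ x y, f x < g y) ∨ ∀ x y, g y < f x := by
      cases d
      · left; intro x y; have := x.postfixRank_lt Dir.left; simp [hf, hg]; omega
      · right; intro x y; have := y.postfixRank_lt Dir.right; simp [hf, hg]; omega
    have hword (w : List (Vertex l ⊕ Vertex r)) :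
        stat (((if b then [root] else []) ++ w.map (ofSubtree (a := a))).map
          fun v : Vertex (.node a l r) => c + v.postfixRank d) = stat (w.map (Sum.elim f g)) := by
      have e : (w.map (ofSubtree (a := a))).map (fun v => c + v.postfixRank d) =
          w.map (Sum.elim f g) := by
        rw [List.map_map]
        refine List.map_congr_left fun x _ => ?_
        rcases x with x | x <;> simp [ofSubtree, postfixRank, hf, hg, add_assoc]
      cases b
      · simpa using congrArg stat e
      · simp only [if_true, List.singleton_append, List.map_cons, e]
        refine hcons _ _ ?_
        simp only [List.mem_map]
        rintro _ ⟨x | x, -, rfl⟩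
        all_goals
          have := x.postfixRank_lt d
          simp only [Sum.elim_inl, Sum.elim_inr, postfixRank, hf, hg]
          split_ifs <;> omega
    have hsum : ((linExt d b (.node a l r)).map
        fun w => q ^ stat (w.map fun v => c + v.postfixRank d)).sum =
        ((linExt d (d = Dir.left) l).map fun u => q ^ stat (u.map f)).sum *
        ((linExt d (d = Dir.right) r).map fun v => q ^ stat (v.map g)).sum *
        qChoose q (numChildOrRoot d (d = Dir.left) l) (numChildOrRoot d (d = Dir.right) r) := by
      rw [linExt, List.sum_map_flatMap_eq, ← List.sum_map_mul_right, ← List.sum_map_mul_right]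
      congr 1
      refine List.map_congr_left fun u hu => ?_
      rw [List.sum_map_flatMap_eq, ← List.sum_map_mul_left, ← List.sum_map_mul_right]
      congr 1
      refine List.map_congr_left fun v hv => ?_
      rw [List.map_map, ← length_of_mem_linExt hu, ← length_of_mem_linExt hv,
        ← hshuffle _ _ f g hfg]
      simp only [Function.comp_def, hword]
    have hl := ihl (d = Dir.left) (c + if d = Dir.left then 0 else r.numNodes)
    have hr := ihr (d = Dir.right) (c + if d = Dir.left then l.numNodes else 0)
    rw [hsum, hookProd_node]
    have h1 := qFactorial_ne_zero hq (numChildOrRoot d (d = Dir.left) l)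
    have h2 := qFactorial_ne_zero hq (numChildOrRoot d (d = Dir.right) r)
    have hfact : qFactorial q (numChildOrRoot d b (.node a l r)) =
        (if b then qInt q (numChildOrRoot d b (.node a l r)) else 1) *
        (qFactorial q (numChildOrRoot d (d = Dir.left) l) *
          qFactorial q (numChildOrRoot d (d = Dir.right) r) *
        qChoose q (numChildOrRoot d (d = Dir.left) l) (numChildOrRoot d (d = Dir.right) r)) := by
      rw [qChoose, mul_div_cancel₀ _ (mul_ne_zero h1 h2), numChildOrRoot_node]
      cases b
      · simp
      · simp only [if_true]
        rw [add_comm 1, qFactorial_succ, mul_comm]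
    rw [hfact, ← hl, ← hr]
    ring

end Vertex

theorem revMaj_cons_of_lt (a : ℕ) (w : List ℕ) (h : ∀ b ∈ w, b < a) :
    revMaj (a :: w) = revMaj w := by
  rcases w with _ | ⟨b, w⟩
  · rfl
  · have := h b (by simp)
    rw [revMaj_cons_cons, if_neg (by omega), add_zero]

theorem revInv_cons_of_lt (a : ℕ) (w : List ℕ) (h : ∀ b ∈ w, b < a) :
    revInv (a :: w) = revInv w := by
  rw [revInv, List.countP_eq_zero.2 fun b hb => by simpa using (h b hb).le, add_zero]

theorem List.countP_ofFn_eq_sum {n : ℕ} (f : Fin n → ℕ) (p : ℕ → Bool) :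
    (List.ofFn f).countP p = ∑ i, if p (f i) = true then 1 else 0 := by
  induction n with
  | zero => simp
  | succ n ih => rw [List.ofFn_succ, List.countP_cons, ih, Fin.sum_univ_succ, add_comm]

theorem List.reverse_ofFn_succ {α : Type*} {n : ℕ} (f : Fin (n + 1) → α) :
    (List.ofFn f).reverse = f (Fin.last n) :: (List.ofFn fun i => f i.castSucc).reverse := by
  rw [List.ofFn_succ', List.concat_eq_append, List.reverse_concat]

theorem revMaj_reverse_ofFn {n : ℕ} (f : Fin n → ℕ) :
    revMaj (List.ofFn f).reverse =
      ∑ i : Fin n, if ∃ h : i.1 + 1 < n, f ⟨i.1 + 1, h⟩ < f i then i.1 + 1 else 0 := by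
  induction n with
  | zero => simp [revMaj]
  | succ n ih =>
    rcases n with _ | n
    · rw [Finset.sum_eq_zero fun i _ => if_neg fun ⟨h, _⟩ => by omega]
      rfl
    · have ih' := ih fun i => f i.castSucc
      rw [Fin.sum_univ_castSucc, if_neg (by simp), add_zero] at ih'
      rw [Fin.sum_univ_castSucc, if_neg (by simp), add_zero, Fin.sum_univ_castSucc,
        List.reverse_ofFn_succ, List.reverse_ofFn_succ, revMaj_cons_cons,
        ← List.reverse_ofFn_succ fun i => f i.castSucc, ih']
      congr 1
      · refine Finset.sum_congr rfl fun i _ => ?_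
        have := i.2
        simp [show i.1 + 1 < n + 1 by omega, show i.1 + 1 < n + 1 + 1 by omega]
      · simp [Fin.last]

theorem revInv_reverse_ofFn {n : ℕ} (f : Fin n → ℕ) :
    revInv (List.ofFn f).reverse =
      (Finset.univ.filter fun p : Fin n × Fin n => p.1 < p.2 ∧ f p.2 < f p.1).card := by
  rw [Finset.card_filter, Fintype.sum_prod_type_right]
  induction n with
  | zero => simp [revInv]
  | succ n ih =>
    rw [List.reverse_ofFn_succ, revInv, ih, List.countP_reverse, List.countP_ofFn_eq_sum,
      Fin.sum_univ_castSucc]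
    congr 1
    · refine Finset.sum_congr rfl fun j _ => ?_
      rw [Fin.sum_univ_castSucc]
      simp [-Finset.sum_boole, (Fin.le_last _).not_gt]
    · rw [Fin.sum_univ_castSucc]
      simp [Fin.castSucc_lt_last, -Finset.sum_boole]

theorem permMaj_eq_revMaj {n : ℕ} (τ : Equiv.Perm (Fin n)) (f : Fin n → ℕ)
    (h : ∀ i j, f i < f j ↔ τ i < τ j) : permMaj n τ = revMaj (List.ofFn f).reverse := by
  simp only [permMaj, revMaj_reverse_ofFn, h]

theorem permInv_eq_revInv {n : ℕ} (τ : Equiv.Perm (Fin n)) (f : Fin n → ℕ)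
    (h : ∀ i j, f i < f j ↔ τ i < τ j) : permInv n τ = revInv (List.ofFn f).reverse := by
  simp only [permInv, revInv_reverse_ofFn, h]

theorem permInv_inv {n : ℕ} (σ : Equiv.Perm (Fin n)) : permInv n σ⁻¹ = permInv n σ := by
  refine Finset.card_bij' (fun p _ => (σ⁻¹ p.2, σ⁻¹ p.1)) (fun p _ => (σ p.2, σ p.1)) ?_ ?_ ?_ ?_
  all_goals simp +contextual

/-- The labellings of the vertices in direction `d` that decrease along ancestry. -/
abbrev DecLabelling (d : Dir) (B : BinaryTree Unit) : Type :=
  {e : ChildVertex d B ≃ Fin (Fintype.card (ChildVertex d B)) //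
    ∀ u v : ChildVertex d B, Vertex.IsAncestor u.1 v.1 → e v < e u}

namespace DecLabelling

open Vertex

variable {d : Dir} {B : BinaryTree Unit}

noncomputable instance : Fintype (DecLabelling d B) := Fintype.ofFinite _

/-- The vertices in the order of decreasing labels. -/
def word (e : ChildVertex d B ≃ Fin (Fintype.card (ChildVertex d B))) : List (Vertex B) :=
  (List.ofFn fun i => (e.symm i).1).reverse

theorem word_injective : Function.Injective (word (d := d) (B := B)) := by
  intro e e' h
  have := List.ofFn_injective (List.reverse_injective h)
  refine Equiv.symm_bijective.injective (Equiv.ext fun i => Subtype.ext (congrFun this i))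

theorem isLinExt_word_iff (e : ChildVertex d B ≃ Fin (Fintype.card (ChildVertex d B))) :
    IsLinExt d false (word e) ↔ ∀ u v : ChildVertex d B, IsAncestor u.1 v.1 → e v < e u := by
  have h1 : ∀ v, v ∈ word e ↔ v.isChildOrRoot d false = true := by
    intro v
    simp only [word, List.mem_reverse, List.mem_ofFn, isChildOrRoot, Bool.false_and,
      Bool.false_or]
    exact ⟨by rintro ⟨i, rfl⟩; exact (e.symm i).2, fun h => ⟨e ⟨v, h⟩, by simp⟩⟩
  rw [IsLinExt, and_iff_right h1, word, List.pairwise_reverse, List.pairwise_ofFn]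
  constructor
  · intro h u v huv
    by_contra hlt
    rcases (not_lt.1 hlt).lt_or_eq with h' | h'
    · have := h h'
      simp only [Equiv.symm_apply_apply] at this
      exact this huv.1
    · exact huv.2 (congrArg Subtype.val (e.injective h'))
  · intro h i j hij hs
    have := h (e.symm i) (e.symm j)
      ⟨hs, fun h' => hij.ne (e.symm.injective (Subtype.ext h'))⟩
    simp only [Equiv.apply_symm_apply] at this
    exact lt_asymm hij this

theorem exists_word_eq {w : List (Vertex B)} (h : IsLinExt d false w) :
    ∃ e : ChildVertex d B ≃ Fin (Fintype.card (ChildVertex d B)), word e = w := by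
  have hmem (v) : v ∈ w ↔ v.isChild d = true := by simpa [isChildOrRoot] using h.1 v
  have hnd : w.Nodup := h.2.imp fun {a b} hab he => hab (by rw [he]; exact hasInSubtree_self b)
  let w' : List (ChildVertex d B) := w.reverse.attachWith _ fun v hv =>
    (hmem v).1 (List.mem_reverse.1 hv)
  have hw' : w'.map Subtype.val = w.reverse :=
    (List.attachWith_map_val _).trans (List.map_id _)
  have hnd' : w'.Nodup := List.Nodup.of_map Subtype.val (by rw [hw']; simpa using hnd)
  have hmem' (v : ChildVertex d B) : v ∈ w' := by
    simpa [w'] using (hmem v.1).2 v.2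
  have hlen : w'.length = Fintype.card (ChildVertex d B) := by
    simpa using Fintype.card_congr (hnd'.getEquivOfForallMemList _ hmem')
  refine ⟨((finCongr hlen.symm).trans (hnd'.getEquivOfForallMemList _ hmem')).symm, ?_⟩
  rw [word, List.reverse_eq_iff, ← hw']
  refine List.ext_getElem (by simp [hlen]) fun i h1 h2 => ?_
  simp [List.Nodup.getEquivOfForallMemList]

theorem sum_word {M : Type*} [AddCommMonoid M] (F : List (Vertex B) → M) :
    ∑ e : DecLabelling d B, F (word e.1) = ((linExt d false B).map F).sum := by
  rw [← List.sum_toFinset F (nodup_linExt d false B)]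
  refine Finset.sum_nbij (fun e => word e.1) ?_ ?_ ?_ fun _ _ => rfl
  · intro e _
    rw [List.mem_toFinset, mem_linExt, isLinExt_word_iff]
    exact e.2
  · intro e _ e' _ h
    exact Subtype.ext (word_injective h)
  · intro w hw
    rw [Finset.mem_coe, List.mem_toFinset, mem_linExt] at hw
    obtain ⟨e, rfl⟩ := exists_word_eq hw
    exact ⟨⟨e, (isLinExt_word_iff e).1 hw⟩, by simp, rfl⟩

theorem strictMono_postfixRank_postfixEquiv (d : Dir) (B : BinaryTree Unit) :
    StrictMono fun i => (postfixEquiv d B i).1.postfixRank d := by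
  intro i j hij
  have h : (childPostfixOrder d B).Pairwise
      fun u v => u.1.postfixRank d < v.1.postfixRank d := by
    rw [childPostfixOrder, List.pairwise_filterMap]
    refine (pairwise_postfixOrder d B).imp fun {u v} huv => ?_
    simp only [Option.dite_none_right_eq_some, Option.some.injEq]
    rintro _ ⟨_, rfl⟩ _ ⟨_, rfl⟩
    exact huv
  exact List.pairwise_iff_get.1 h _ _ hij

theorem postfixRank_symm_lt_iff (e : ChildVertex d B ≃ Fin (Fintype.card (ChildVertex d B)))
    (i j : Fin (Fintype.card (ChildVertex d B))) :
    (e.symm i).1.postfixRank d < (e.symm j).1.postfixRank d ↔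
      (show Equiv.Perm _ from (postfixEquiv d B).trans e)⁻¹ i <
        (show Equiv.Perm _ from (postfixEquiv d B).trans e)⁻¹ j := by
  rw [← (strictMono_postfixRank_postfixEquiv d B).lt_iff_lt]
  simp [Equiv.Perm.inv_def]

theorem map_word (e : ChildVertex d B ≃ Fin (Fintype.card (ChildVertex d B))) {β : Type*}
    (f : Vertex B → β) :
    (word e).map f = (List.ofFn fun i => f (e.symm i).1).reverse := by
  rw [word, List.map_reverse, List.map_ofFn]
  rfl

theorem permImaj_eq (e : ChildVertex d B ≃ Fin (Fintype.card (ChildVertex d B))) :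
    permImaj _ ((postfixEquiv d B).trans e) = revMaj ((word e).map (·.postfixRank d)) := by
  rw [map_word]
  exact permMaj_eq_revMaj _ _ (postfixRank_symm_lt_iff e)

theorem permInv_eq (e : ChildVertex d B ≃ Fin (Fintype.card (ChildVertex d B))) :
    permInv _ ((postfixEquiv d B).trans e) = revInv ((word e).map (·.postfixRank d)) := by
  rw [map_word, ← permInv_inv]
  exact permInv_eq_revInv _ _ (postfixRank_symm_lt_iff e)

end DecLabelling

section HookFormula

variable {K : Type*} [Field K] {q : K}

@[to_additive]
theorem Fintype.prod_ite_eq_prod_subtype {ι M : Type*} [Fintype ι] [CommMonoid M] (p : ι → Prop)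
    [DecidablePred p] (f : ι → M) :
    (∏ i, if p i then f i else 1) = ∏ i : {i // p i}, f i := by
  rw [← Finset.prod_filter]
  exact Finset.prod_subtype _ (by simp) f

theorem numChildOrRoot_false (d : Dir) (B : BinaryTree Unit) :
    Vertex.numChildOrRoot d false B = Fintype.card (ChildVertex d B) := by
  simp [Vertex.numChildOrRoot, Vertex.isChildOrRoot, Fintype.card_subtype]

theorem hookProd_false (q : K) (d : Dir) (B : BinaryTree Unit) :
    Vertex.hookProd q d false B = ∏ U : ChildVertex d B, qInt q (hookSize U) := by
  simp only [Vertex.hookProd, Vertex.isChildOrRoot, Bool.false_and, Bool.false_or,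
    Fintype.prod_ite_eq_prod_subtype, ite_and]
  refine Finset.prod_congr rfl fun U _ => ?_
  rw [Fintype.sum_ite_eq_sum_subtype, hookSize, Finset.card_filter]

theorem hookSize_pos {d : Dir} {B : BinaryTree Unit} (U : ChildVertex d B) : 0 < hookSize U :=
  Finset.card_pos.2 ⟨U, by simp [Vertex.hasInSubtree_self]⟩

theorem sum_decLabelling_eq (hq : ∀ n, 0 < n → qInt q n ≠ 0) (stat : List ℕ → ℕ)
    (hnil : stat [] = 0) (hcons : ∀ a w, (∀ b ∈ w, b < a) → stat (a :: w) = stat w)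
    (hshuffle : ∀ (α β : Type) (f : α → ℕ) (g : β → ℕ),
      ((∀ x y, f x < g y) ∨ ∀ x y, g y < f x) → ∀ (u : List α) (v : List β),
      ((shuffle u v).map fun w => q ^ stat (w.map (Sum.elim f g))).sum =
        q ^ stat (u.map f) * q ^ stat (v.map g) * qChoose q u.length v.length)
    (d : Dir) (B : BinaryTree Unit) :
    ∑ e : DecLabelling d B, q ^ stat ((DecLabelling.word e.1).map (·.postfixRank d)) =
      qFactorial q (Fintype.card (ChildVertex d B)) /
        ∏ U : ChildVertex d B, qInt q (hookSize U) := by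
  rw [eq_div_iff (Finset.prod_ne_zero_iff.2 fun U _ => hq _ (hookSize_pos U)),
    ← hookProd_false, DecLabelling.sum_word fun w => q ^ stat (w.map (·.postfixRank d))]
  have := Vertex.sum_linExt_mul_hookProd hq stat hnil hcons hshuffle d false B 0
  simpa only [zero_add, numChildOrRoot_false] using this

theorem sum_decLabelling_permInv (hq : ∀ n, 0 < n → qInt q n ≠ 0) (d : Dir)
    (B : BinaryTree Unit) :
    ∑ e : DecLabelling d B, q ^ permInv _ ((postfixEquiv d B).trans e.1) =
      qFactorial q (Fintype.card (ChildVertex d B)) /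
        ∏ U : ChildVertex d B, qInt q (hookSize U) := by
  simp only [DecLabelling.permInv_eq]
  exact sum_decLabelling_eq hq revInv rfl revInv_cons_of_lt
    (fun _ _ f g hfg u v => sum_shuffle_revInv hq f g hfg u v) d B

theorem sum_decLabelling_permImaj (hq : ∀ n, 0 < n → qInt q n ≠ 0) (d : Dir)
    (B : BinaryTree Unit) :
    ∑ e : DecLabelling d B, q ^ permImaj _ ((postfixEquiv d B).trans e.1) =
      qFactorial q (Fintype.card (ChildVertex d B)) /
        ∏ U : ChildVertex d B, qInt q (hookSize U) := by
  simp only [DecLabelling.permImaj_eq]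
  refine sum_decLabelling_eq hq revMaj rfl revMaj_cons_of_lt
    (fun _ _ f g hfg u v => sum_shuffle_revMaj hq f g (fun x y => ?_) u v) d B
  rcases hfg with h | h
  exacts [(h x y).ne, (h x y).ne']

/-- A non-ambiguous tree is a pair of a decreasing labelling of the left vertices and a decreasing
labelling of the right vertices. -/
def NAT.equivProd (B : BinaryTree Unit) :
    NAT B ≃ DecLabelling Dir.left B × DecLabelling Dir.right B where
  toFun T := (⟨T.leftLabel, T.left_decreasing⟩, ⟨T.rightLabel, T.right_decreasing⟩)
  invFun p := ⟨p.1.1, p.2.1, p.1.2, p.2.2⟩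
  left_inv _ := rfl
  right_inv _ := rfl

theorem NAT.sum_weight (qL qR : K) (S : (n : ℕ) → Equiv.Perm (Fin n) → ℕ)
    (B : BinaryTree Unit) :
    ∑ T : NAT B, T.weight qL qR S =
      (∑ e : DecLabelling Dir.left B, qL ^ S _ ((postfixEquiv Dir.left B).trans e.1)) *
      ∑ e : DecLabelling Dir.right B, qR ^ S _ ((postfixEquiv Dir.right B).trans e.1) := by
  rw [Finset.sum_mul_sum, ← Fintype.sum_prod_type']
  exact Fintype.sum_equiv (NAT.equivProd B) _ _ fun _ => rfl

theorem one_sub_qVar_pow_ne_zero (d : Dir) {n : ℕ} (hn : 0 < n) : 1 - qVar d ^ n ≠ 0 := by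
  intro h
  have h1 : algebraMap (MvPolynomial Dir ℚ) QField (1 - MvPolynomial.X d ^ n) = 0 := by
    simpa [qVar] using h
  rw [map_eq_zero_iff _ (IsFractionRing.injective (MvPolynomial Dir ℚ) QField)] at h1
  have h2 := congrArg (MvPolynomial.eval fun _ => (0 : ℚ)) h1
  simp [hn.ne'] at h2

theorem qInt_qVar_ne_zero (d : Dir) (n : ℕ) (hn : 0 < n) : qInt (qVar d) n ≠ 0 :=
  div_ne_zero (one_sub_qVar_pow_ne_zero d hn)
    (by simpa using one_sub_qVar_pow_ne_zero d one_pos)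

end HookFormula

theorem mainTheorem2 (B : BinaryTree Unit) (hB : B ≠ BinaryTree.nil) :
    (∑ T : NAT B, T.weight (qVar Dir.left) (qVar Dir.right) permInv =
      ∑ T : NAT B, T.weight (qVar Dir.left) (qVar Dir.right) permImaj) ∧
    (∑ T : NAT B, T.weight (qVar Dir.left) (qVar Dir.right) permImaj =
      (qFactorial (qVar Dir.left) (Fintype.card (LV B)) *
        qFactorial (qVar Dir.right) (Fintype.card (RV B))) /
      ((∏ U : LV B, qInt (qVar Dir.left) (hookSize U)) *
        ∏ U : RV B, qInt (qVar Dir.right) (hookSize U))) := by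
  have h (d : Dir) := qInt_qVar_ne_zero d
  rw [NAT.sum_weight, NAT.sum_weight, sum_decLabelling_permInv (h _),
    sum_decLabelling_permInv (h _), sum_decLabelling_permImaj (h _),
    sum_decLabelling_permImaj (h _)]
  exact ⟨rfl, div_mul_div_comm _ _ _ _⟩
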